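/- Let $G$ be a compact topological group and let $Y$ be a stratifiable $G$-space; that is, $Y$ is a Hausdorff space with a continuous action $G\times Y\to Y$, and to every open set $U\subset Y$ there is assigned a sequence $(U_n)_{n\ge 1}$ of open sets such that $\overline{U_n}\subset U$, $\bigcup_n U_n=U$, and $U_n\subset V_n$ for all $n$ whenever $U\subset V$. Let $X\subset Y$ be a nonempty closed $G$-invariant subset. For a $G$-space $Z$ let $C_{inv}(Z\times Z)$ be the linear space of continuous functions $f:Z\times Z\to\mathbb R$ with $f(gx,gy)=f(x,y)$ for all $g\in G$ and $x,y\in Z$, equipped with the compact-open topology. Theorem 4.1. There is a linear operator $T:C_{inv}(X\times X)\to C_{inv}(Y\times Y)$ such that - $T$ is regular: $T(f)\ge 0$ whenever $f\ge 0$, and $T(1_{X\times X})=1_{Y\times Y}$; - $T$ is an extension operator: $T(f)|_{X\times X}=f$ for every $f$; - $T$ is continuous with respect to the compact-open topologies; - if $p\in C_{inv}(X\times X)$ is a pseudometric on $X$, then $T(p)$ is a pseudometric on $Y$; - if $G$ is finite, then $T$ is also continuous with respect to the topologies of pointwise convergence on $C_{inv}(X\times X)$ and $C_{inv}(Y\times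 Y)$. -/

import Mathlib

open TopologicalSpace
open scoped Topology

/-- A Hausdorff space is stratifiable if to every open set `U` one can assign a sequence
`S U 0, S U 1, …` of open sets with closures contained in `U` and union `U`, in such a way that
`S U n ⊆ S V n` for all `n` whenever `U ⊆ V`. -/
class StratifiableSpace (Y : Type*) [TopologicalSpace Y] : Prop extends T2Space Y where
  exists_stratification : ∃ S : Opens Y → ℕ → Opens Y,
    (∀ U n, closure (S U n : Set Y) ⊆ U) ∧
    (∀ U, ⋃ n, (S U n : Set Y) = U) ∧
    (∀ U V, U ≤ V → ∀ n, S U n ≤ S V n)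

section InvariantFunctions

variable (G : Type*) [Group G] (Z : Type*) [TopologicalSpace Z] [MulAction G Z]

/-- The linear space `C_inv(Z × Z)` of continuous functions `f : Z × Z → ℝ` which are invariant
under the diagonal action. As a subspace of `C(Z × Z, ℝ)` it carries the compact-open topology. -/
def CInv : Submodule ℝ C(Z × Z, ℝ) where
  carrier := {f | ∀ (g : G) (x y : Z), f (g • x, g • y) = f (x, y)}
  zero_mem' := fun _ _ _ => rfl
  add_mem' := fun {f₁ f₂} h₁ h₂ g x y => by
    simp only [ContinuousMap.add_apply, h₁ g x y, h₂ g x y]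
  smul_mem' := fun c f h g x y => by
    simp only [ContinuousMap.smul_apply, h g x y]

/-- The constant unit function on `Z × Z`, as an element of `C_inv(Z × Z)`. -/
def CInv.unit : CInv G Z := ⟨ContinuousMap.const (Z × Z) 1, fun _ _ _ => rfl⟩

/-- The topology of pointwise convergence on `C_inv(Z × Z)`. -/
abbrev CInv.pointwiseTopology : TopologicalSpace (CInv G Z) :=
  TopologicalSpace.induced (fun (f : CInv G Z) (z : Z × Z) => f.1 z) Pi.topologicalSpace

variable {G Z}

/-- The function `f : Z × Z → ℝ` is a pseudometric on the set `Z`. -/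
def CInv.IsPseudometric (f : CInv G Z) : Prop :=
  ∃ d : PseudoMetric Z ℝ, ∀ x y : Z, f.1 (x, y) = d x y

end InvariantFunctions

section Operators

variable {G : Type*} [Group G] {Y : Type*} [TopologicalSpace Y] [MulAction G Y]

/-- A linear operator `C_inv(X × X) → C_inv(Y × Y)` is regular if it is positive and sends the
unit function to the unit function. -/
def IsRegularOperator {X : SubMulAction G Y} (T : CInv G X →ₗ[ℝ] CInv G Y) : Prop :=
  (∀ f : CInv G X, (∀ z, 0 ≤ f.1 z) → ∀ w, 0 ≤ (T f).1 w) ∧ T (CInv.unit G X) = CInv.unit G Y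

/-- `T : C_inv(X × X) → C_inv(Y × Y)` is an extension operator if `T f` restricts to `f` on
`X × X`, for every `f`. -/
def IsExtensionOperator {X : SubMulAction G Y} (T : CInv G X →ₗ[ℝ] CInv G Y) : Prop :=
  ∀ (f : CInv G X) (x y : X), (T f).1 ((x : Y), (y : Y)) = f.1 (x, y)

end Operators

/-! ### Monotone stratifications and normality -/

open Set Filter MeasureTheory

/-! Attach to each `y` in `Y` a random point `sel y t` of `X`, with `t` uniform in `(0, 1]` and the
same `t` for all `y`, and extend `f` by the expectation of `f (sel y t, sel y' t)`. Sharing `t` is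
what preserves pseudometrics: the diagonal still gives `0`, and the triangle inequality can be
integrated pointwise. Averaging over Haar measure on `G` then gives invariance.

Off `X`, cut functions divide `(0, 1]` into intervals, locally finitely many of them nondegenerate,
and each interval carries a point of `X` (`exists_cutScheme`). The points come from Borges' choice
`exists_retraction_near`, made locally constant by `exists_sigma_disjoint_refinement`. The finite
sets `supp y` of possible values are upper semicontinuous and shrink to `{y}` on `X`. This gives
continuity of the extended functions (`continuous_mean`), and compact sets of `y` have compact total
support, whence continuity of the operator. -/

/-- A stratification of a topological space, increasing in the index, and extended to arbitrary
sets in a monotone way. -/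
structure IsStratification {Y : Type*} [TopologicalSpace Y] (S : Set Y → ℕ → Set Y) : Prop where
  isOpen : ∀ U n, IsOpen (S U n)
  closure_subset : ∀ U n, closure (S U n) ⊆ U
  exists_mem : ∀ U, IsOpen U → ∀ y ∈ U, ∃ n, y ∈ S U n
  mono : ∀ U V, U ⊆ V → ∀ n, S U n ⊆ S V n
  monotone : ∀ U, Monotone (S U)

theorem exists_isStratification (Y : Type*) [TopologicalSpace Y] [StratifiableSpace Y] :
    ∃ S : Set Y → ℕ → Set Y, IsStratification S := by
  obtain ⟨S, h1, h2, h3⟩ := StratifiableSpace.exists_stratification (Y := Y)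
  refine ⟨fun U n => ⋃ i ∈ Iic n, (S ⟨interior U, isOpen_interior⟩ i : Set Y), ?_, ?_, ?_, ?_, ?_⟩
  · exact fun U n => isOpen_biUnion fun i _ => (S _ i).isOpen
  · intro U n
    rw [(finite_Iic n).closure_biUnion]
    exact iUnion₂_subset fun i _ => (h1 _ i).trans interior_subset
  · intro U hU y hy
    have : y ∈ ⋃ n, (S ⟨interior U, isOpen_interior⟩ n : Set Y) := by
      rw [h2]; simpa [hU.interior_eq] using hy
    obtain ⟨n, hn⟩ := mem_iUnion.1 this
    exact ⟨n, mem_biUnion (mem_Iic.2 le_rfl) hn⟩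
  · intro U V hUV n
    exact biUnion_mono subset_rfl fun i _ =>
      h3 ⟨interior U, isOpen_interior⟩ ⟨interior V, isOpen_interior⟩ (interior_mono hUV) i
  · intro U m n hmn
    exact biUnion_subset_biUnion_left (Iic_subset_Iic.2 hmn)

namespace IsStratification

variable {Y : Type*} [TopologicalSpace Y] {S : Set Y → ℕ → Set Y}

theorem subset (hS : IsStratification S) (U : Set Y) (n : ℕ) : S U n ⊆ U :=
  subset_closure.trans (hS.closure_subset U n)

/-- Monotonicity in the index makes pieces of different levels disjoint: what the lower level keeps,
the higher level on the other side deletes. -/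
theorem normalSpace (hS : IsStratification S) : NormalSpace Y := by
  have key : ∀ H K : Set Y, ∀ m n, m ≤ n →
      Disjoint (S Kᶜ m \ closure (S Hᶜ m)) (S Hᶜ n \ closure (S Kᶜ n)) := by
    intro H K m n hmn
    rw [Set.disjoint_left]
    exact fun z hz hz' => hz'.2 (subset_closure (hS.monotone _ hmn hz.1))
  refine ⟨fun H K hH hK hHK => ⟨⋃ n, S Kᶜ n \ closure (S Hᶜ n), ⋃ n, S Hᶜ n \ closure (S Kᶜ n),
    isOpen_iUnion fun n => (hS.isOpen _ _).sdiff isClosed_closure,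
    isOpen_iUnion fun n => (hS.isOpen _ _).sdiff isClosed_closure, ?_, ?_, ?_⟩⟩
  · intro x hx
    obtain ⟨n, hn⟩ := hS.exists_mem _ hK.isOpen_compl x (Set.disjoint_left.1 hHK hx)
    exact mem_iUnion.2 ⟨n, hn, fun h => hS.closure_subset _ _ h hx⟩
  · intro x hx
    obtain ⟨n, hn⟩ := hS.exists_mem _ hH.isOpen_compl x (Set.disjoint_right.1 hHK hx)
    exact mem_iUnion.2 ⟨n, hn, fun h => hS.closure_subset _ _ h hx⟩
  · simp only [Set.disjoint_iUnion_left, Set.disjoint_iUnion_right]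
    intro n m
    rcases le_total m n with h | h
    · exact key H K _ _ h
    · exact (key K H _ _ h).symm

end IsStratification

/-! ### Borges neighbourhoods, choice of points, disjoint refinements -/

section Borges

variable {Y : Type*} [TopologicalSpace Y]

/-- The first index at which the stratification of `U` captures `x`. -/
noncomputable def stratRank (S : Set Y → ℕ → Set Y) (U : Set Y) (x : Y) : ℕ :=
  sInf {n | x ∈ S U n}

/-- The Borges neighbourhood of `x` in `U`. -/
def borgesNhd (S : Set Y → ℕ → Set Y) (U : Set Y) (x : Y) : Set Y :=
  S U (stratRank S U x) \ closure (S {x}ᶜ (stratRank S U x))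

variable {S : Set Y → ℕ → Set Y}

namespace IsStratification

theorem isOpen_borgesNhd (hS : IsStratification S) (U : Set Y) (x : Y) :
    IsOpen (borgesNhd S U x) :=
  (hS.isOpen _ _).sdiff isClosed_closure

theorem mem_borgesNhd (hS : IsStratification S) {U : Set Y} (hU : IsOpen U) {x : Y} (hx : x ∈ U) :
    x ∈ borgesNhd S U x :=
  ⟨Nat.sInf_mem (s := {n | x ∈ S U n}) (hS.exists_mem U hU x hx),
    fun h => hS.closure_subset _ _ h rfl⟩

/-- If `y ∉ U` then `U ⊆ {y}ᶜ`, so by monotonicity `z` lies in the very set deleted from the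
neighbourhood of `y`. -/
theorem mem_of_borgesNhd_inter (hS : IsStratification S) {U V : Set Y} {x y z : Y}
    (hx : z ∈ borgesNhd S U x) (hy : z ∈ borgesNhd S V y)
    (h : stratRank S U x ≤ stratRank S V y) : y ∈ U := by
  by_contra hyU
  exact hy.2 (subset_closure (hS.monotone _ h
    (hS.mono U {y}ᶜ (subset_compl_singleton_iff.2 hyU) _ hx.1)))

/-- Borges' choice of points in a closed set. -/
theorem exists_retraction_near (hS : IsStratification S) {X : Set Y} (hX : IsClosed X)
    (hne : X.Nonempty) :
    ∃ a : Y → X, ∀ x ∈ X, ∀ U, IsOpen U → x ∈ U → ∃ N, IsOpen N ∧ x ∈ N ∧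
      ∀ y ∉ X, (N ∩ borgesNhd S Xᶜ y).Nonempty → (a y : Y) ∈ U := by
  have hW : IsOpen Xᶜ := hX.isOpen_compl
  have hlt : ∀ y ∉ X, ∀ x ∈ X, ∀ U, ∀ z, z ∈ borgesNhd S U x → z ∈ borgesNhd S Xᶜ y →
      stratRank S U x < stratRank S Xᶜ y := by
    intro y hy x hx U z hz hz'
    by_contra! h
    exact hS.mem_of_borgesNhd_inter hz' hz h hx
  -- The point `a y` is chosen with a neighbourhood of maximal rank around `y`; ranks are bounded by
  -- that of `Xᶜ` at `y`. By the rank comparison, `a y` then lies in every competing `U`.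
  have ex : ∀ y : Y, ∃ a : X, ∀ x ∈ X, ∀ U, IsOpen U → x ∈ U → y ∉ X → y ∈ borgesNhd S U x →
      ∃ U', y ∈ borgesNhd S U' a ∧ stratRank S U x ≤ stratRank S U' a := by
    intro y
    by_cases hex : y ∉ X ∧ ∃ x ∈ X, ∃ U, IsOpen U ∧ x ∈ U ∧ y ∈ borgesNhd S U x
    · obtain ⟨hy, x0, hx0, U0, -, -, h0⟩ := hex
      let R : Set ℕ := {n | ∃ x ∈ X, ∃ U, y ∈ borgesNhd S U x ∧ stratRank S U x = n}
      have hRne : R.Nonempty := ⟨_, x0, hx0, U0, h0, rfl⟩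
      have hRb : BddAbove R := by
        refine ⟨stratRank S Xᶜ y, ?_⟩
        rintro n ⟨x, hx, U, hyU, rfl⟩
        exact (hlt y hy x hx U y hyU (hS.mem_borgesNhd hW hy)).le
      obtain ⟨x, hx, U, hyU, hR⟩ := Nat.sSup_mem hRne hRb
      refine ⟨⟨x, hx⟩, fun x' hx' U' _ _ _ hy' => ⟨U, hyU, ?_⟩⟩
      rw [show stratRank S U (⟨x, hx⟩ : X) = sSup R from hR]
      exact le_csSup hRb ⟨x', hx', U', hy', rfl⟩
    -- No neighbourhood competes for `y`, so any point will do.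
    · refine ⟨⟨hne.some, hne.some_mem⟩, fun x hx U hU hxU hy hyU => (hex ?_).elim⟩
      exact ⟨hy, x, hx, U, hU, hxU, hyU⟩
  choose a ha using ex
  refine ⟨a, fun x hx U hU hxU => ?_⟩
  have hV := hS.isOpen_borgesNhd U x
  have hxV := hS.mem_borgesNhd hU hxU
  -- The construction is iterated: meeting the inner neighbourhood forces `y` into the outer one,
  -- where the choice of `a y` applies.
  refine ⟨borgesNhd S (borgesNhd S U x) x, hS.isOpen_borgesNhd _ _, hS.mem_borgesNhd hV hxV, ?_⟩
  rintro y hy ⟨z, hz, hz'⟩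
  have hyV : y ∈ borgesNhd S U x :=
    hS.mem_of_borgesNhd_inter hz hz' (hlt y hy x hx _ z hz hz').le
  obtain ⟨U', h1, h2⟩ := ha y x hx U hU hxU hy hyV
  exact hS.mem_of_borgesNhd_inter hyV h1 h2

/-- Every open cover of an open set in a stratifiable space has a `σ`-disjoint open refinement. -/
theorem exists_sigma_disjoint_refinement (hS : IsStratification S) {ι : Type*} (U : ι → Set Y)
    (hU : ∀ i, IsOpen (U i)) :
    ∃ O : ℕ → ι → Set Y, (∀ k i, IsOpen (O k i)) ∧ (∀ k i, O k i ⊆ U i) ∧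
      (∀ k, Pairwise fun i j => Disjoint (O k i) (O k j)) ∧
      ⋃ k, ⋃ i, O k i = ⋃ i, U i := by
  obtain ⟨_, hwo⟩ := exists_wellFoundedLT ι
  let V : ι → Set Y := fun i => ⋃ j ∈ Iic i, U j
  let V' : ι → Set Y := fun i => ⋃ j ∈ Iio i, U j
  have hVo : ∀ i, IsOpen (V i) := fun i => isOpen_biUnion fun j _ => hU j
  -- For `i < j` one has `V i ⊆ V' j`, so the `j`-th set deletes the `i`-th at the same level. A
  -- point is covered at the least index whose `U i` contains it.
  refine ⟨fun k i => (S (V i) k ∩ U i) \ closure (S (V' i) k), ?_, ?_, ?_, ?_⟩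
  · exact fun k i => ((hS.isOpen _ _).inter (hU i)).sdiff isClosed_closure
  · exact fun k i => sdiff_subset.trans inter_subset_right
  · have key : ∀ k i j, i < j → Disjoint ((S (V i) k ∩ U i) \ closure (S (V' i) k))
        ((S (V j) k ∩ U j) \ closure (S (V' j) k)) := by
      intro k i j hij
      rw [Set.disjoint_left]
      refine fun z hz hz' => hz'.2 (subset_closure (hS.mono (V i) (V' j) ?_ k hz.1.1))
      exact biUnion_subset_biUnion_left fun l hl => lt_of_le_of_lt hl hij
    intro k i j hij
    rcases lt_or_gt_of_ne hij with h | h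
    · exact key k i j h
    · exact (key k j i h).symm
  · apply Subset.antisymm
    · exact iUnion_subset fun k => iUnion_mono fun i => sdiff_subset.trans inter_subset_right
    · intro y hy
      have hne : {i | y ∈ U i}.Nonempty := mem_iUnion.1 hy
      let i := hwo.wf.min {i | y ∈ U i} hne
      have hi : y ∈ U i := hwo.wf.min_mem _ hne
      obtain ⟨k, hk⟩ := hS.exists_mem (V i) (hVo i) y (mem_biUnion (mem_Iic.2 le_rfl) hi)
      refine mem_iUnion₂.2 ⟨k, i, ⟨hk, hi⟩, fun h => ?_⟩
      obtain ⟨j, hj, hyj⟩ := mem_iUnion₂.1 (hS.closure_subset _ _ h)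
      exact hwo.wf.not_lt_min {i | y ∈ U i} hyj hj

end IsStratification

end Borges

/-! ### Construction of the cut scheme -/

theorem exists_tsupport_subset_eqOn_one {Y : Type*} [TopologicalSpace Y] [NormalSpace Y]
    {C O : Set Y} (hC : IsClosed C) (hO : IsOpen O) (h : C ⊆ O) :
    ∃ g : C(Y, ℝ), tsupport g ⊆ O ∧ EqOn g 1 C ∧ ∀ y, g y ∈ Icc (0 : ℝ) 1 := by
  obtain ⟨V, hV, hCV, hVO⟩ := normal_exists_closure_subset hC hO h
  obtain ⟨g, h0, h1, h2⟩ := exists_continuous_zero_one_of_isClosed hV.isClosed_compl hC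
    (disjoint_compl_left_iff_subset.2 hCV)
  refine ⟨g, (closure_mono ?_).trans hVO, h1, h2⟩
  intro y hy
  by_contra hyV
  exact hy (h0 hyV)

/-- The data which defines the extension operator: an increasing sequence of cut functions
`cut n` with values in `[0, 1]`, and points `pt n y` of `X` attached to the intervals
`[cut n y, cut (n + 1) y)`, such that `pt n` is locally constant off `X` where it matters, and
`pt n y` is near `x ∈ X` if `y` is near `x`. -/
structure CutScheme {Y : Type*} [TopologicalSpace Y] (X : Set Y) where
  /-- the cut functions -/
  cut : ℕ → C(Y, ℝ)
  /-- the points attached to the intervals between the cuts -/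
  pt : ℕ → Y → X
  cut_zero : ∀ y, cut 0 y = 0
  cut_mono : ∀ y, Monotone fun n => cut n y
  cut_le_one : ∀ n y, cut n y ≤ 1
  eventually_cut_eq_one : ∀ y ∉ X, ∃ n, ∀ᶠ z in 𝓝 y, cut n z = 1
  eventually_pt_eq : ∀ y ∉ X, ∀ n, y ∈ tsupport (cut (n + 1) - cut n) → ∀ᶠ z in 𝓝 y,
    pt n z = pt n y
  eventually_pt_mem : ∀ x ∈ X, ∀ U ∈ 𝓝 x, ∀ᶠ z in 𝓝 x, ∀ n,
    z ∈ tsupport (cut (n + 1) - cut n) → (pt n z : Y) ∈ U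

theorem exists_cutScheme {Y : Type*} [TopologicalSpace Y] [StratifiableSpace Y] {X : Set Y}
    (hX : IsClosed X) (hne : X.Nonempty) : Nonempty (CutScheme X) := by
  classical
  obtain ⟨S, hS⟩ := exists_isStratification Y
  have := hS.normalSpace
  obtain ⟨a, ha⟩ := hS.exists_retraction_near hX hne
  obtain ⟨O, hOo, hOU, hOd, hOW⟩ := hS.exists_sigma_disjoint_refinement
    (fun y : (Xᶜ : Set Y) => borgesNhd S Xᶜ y) (fun y => hS.isOpen_borgesNhd _ _)
  have hOko : ∀ k, IsOpen (⋃ i, O k i) := fun k => isOpen_iUnion (hOo k)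
  have hg : ∀ k l, ∃ g : C(Y, ℝ), tsupport g ⊆ ⋃ i, O k i ∧
      EqOn g 1 (closure (S (⋃ i, O k i) l)) ∧ ∀ y, g y ∈ Icc (0 : ℝ) 1 := fun k l =>
    exists_tsupport_subset_eqOn_one isClosed_closure (hOko k) (hS.closure_subset _ _)
  choose g hgO hg1 hgI using hg
  -- The pairs (disjoint family `k`, level `l`) are listed in one sequence. Running maxima then give
  -- increasing cuts, equal to `1` as soon as one bump function is.
  let G : ℕ → C(Y, ℝ) := fun n => g n.unpair.1 n.unpair.2
  obtain ⟨c, hc0, hcs⟩ : ∃ c : ℕ → C(Y, ℝ), c 0 = 0 ∧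
      ∀ n y, c (n + 1) y = max (c n y) (G n y) :=
    ⟨fun n => n.rec 0 fun k ck => ck ⊔ G k, rfl, fun n y => rfl⟩
  -- Disjointness makes the index unique; by `hsupp` below, the default is never used on the support
  -- of an increment.
  let b : ℕ → Y → X := fun n z =>
    if h : ∃ i, z ∈ O n.unpair.1 i then a (h.choose : Y) else ⟨hne.some, hne.some_mem⟩
  have hb : ∀ n i z, z ∈ O n.unpair.1 i → b n z = a i := by
    intro n i z hz
    have h : ∃ i, z ∈ O n.unpair.1 i := ⟨i, hz⟩
    have : h.choose = i := by
      by_contra hne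
      exact Set.disjoint_left.1 (hOd _ hne) h.choose_spec hz
    simp only [b, dif_pos h, this]
  have hcm : ∀ y, Monotone fun n => c n y := fun y =>
    monotone_nat_of_le_succ fun n => by rw [hcs]; exact le_max_left _ _
  have hcnn : ∀ n y, 0 ≤ c n y := fun n y => by
    simpa [hc0] using hcm y (Nat.zero_le n)
  have hsupp : ∀ n, tsupport (c (n + 1) - c n) ⊆ ⋃ i, O n.unpair.1 i := by
    intro n
    refine (closure_mono ?_).trans (hgO n.unpair.1 n.unpair.2)
    intro y hy h0
    apply hy
    have : G n y = 0 := h0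
    simp [hcs, this, hcnn]
  have hc1 : ∀ n y, c n y ≤ 1 := by
    intro n y
    induction n with
    | zero => simp [hc0]
    | succ n ih => rw [hcs]; exact max_le ih (hgI _ _ _).2
  refine ⟨⟨c, b, fun y => by simp [hc0], hcm, hc1, ?_, ?_, ?_⟩⟩
  · intro y hy
    have hy' : y ∈ ⋃ k, ⋃ i, O k i := by
      rw [hOW]
      exact mem_iUnion.2 ⟨⟨y, hy⟩, hS.mem_borgesNhd hX.isOpen_compl hy⟩
    obtain ⟨k, hk⟩ := mem_iUnion.1 hy'
    obtain ⟨l, hl⟩ := hS.exists_mem _ (hOko k) y hk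
    refine ⟨Nat.pair k l + 1, ?_⟩
    filter_upwards [(hS.isOpen _ _).mem_nhds hl] with z hz
    refine le_antisymm (hc1 _ _) ?_
    rw [hcs]
    have : G (Nat.pair k l) z = 1 := by
      simp only [G, Nat.unpair_pair]
      exact hg1 k l (subset_closure hz)
    rw [this]
    exact le_max_right _ _
  · intro y hy n hyn
    obtain ⟨i, hi⟩ := mem_iUnion.1 (hsupp n hyn)
    filter_upwards [(hOo _ _).mem_nhds hi] with z hz
    rw [hb n i z hz, hb n i y hi]
  · intro x hx U hU
    obtain ⟨U', hU'U, hU', hxU'⟩ := mem_nhds_iff.1 hU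
    obtain ⟨N, hN, hxN, h⟩ := ha x hx U' hU' hxU'
    filter_upwards [hN.mem_nhds hxN] with z hz n hzn
    obtain ⟨i, hi⟩ := mem_iUnion.1 (hsupp n hzn)
    rw [hb n i z hi]
    exact hU'U (h i i.2 ⟨z, hz, hOU _ _ hi⟩)

/-! ### Random selection and its supports -/

namespace CutScheme

variable {Y : Type*} [TopologicalSpace Y] {X : Set Y} (D : CutScheme X)

/-- The index of the interval `(cut n y, cut (n + 1) y]` which contains `t`. -/
noncomputable def idx (y : Y) (t : ℝ) : ℕ := sInf {n | t ≤ D.cut (n + 1) y}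

open Classical in
/-- The point of `X` attached to `y` and the index `n`; it is `y` itself if `y ∈ X`. -/
noncomputable def val (y : Y) (n : ℕ) : X := if h : y ∈ X then ⟨y, h⟩ else D.pt n y

/-- The random point of `X` attached to `y`, where the randomness is `t ∈ (0, 1]`. -/
noncomputable def sel (y : Y) (t : ℝ) : X := D.val y (D.idx y t)

/-- The set of points which are relevant to `y`. -/
def supp (y : Y) : Set X :=
  {p | (p : Y) = y ∨ (y ∉ X ∧ ∃ n, y ∈ tsupport (D.cut (n + 1) - D.cut n) ∧ D.pt n y = p)}

variable {D}

theorem idx_eq {y : Y} {t : ℝ} {n : ℕ} (ht : t ∈ Ioc (D.cut n y) (D.cut (n + 1) y)) :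
    D.idx y t = n := by
  refine le_antisymm (Nat.sInf_le ht.2) ?_
  refine le_csInf ⟨n, ht.2⟩ fun k hk => ?_
  by_contra! hkn
  exact absurd (ht.1.trans_le (le_trans hk (D.cut_mono y hkn))) (lt_irrefl _)

theorem mem_Ioc_of_idx {y : Y} {t : ℝ} (h0 : 0 < t) (h : ∃ n, t ≤ D.cut n y) :
    t ∈ Ioc (D.cut (D.idx y t) y) (D.cut (D.idx y t + 1) y) := by
  obtain ⟨n, hn⟩ := h
  have hmem : D.idx y t ∈ {n | t ≤ D.cut (n + 1) y} :=
    Nat.sInf_mem ⟨n, hn.trans (D.cut_mono y n.le_succ)⟩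
  refine ⟨?_, hmem⟩
  rcases hk : D.idx y t with _ | k
  · rwa [D.cut_zero]
  · by_contra! hle
    have : D.idx y t ≤ k := Nat.sInf_le hle
    omega

theorem exists_le_cut {y : Y} (hy : y ∉ X) {t : ℝ} (ht : t ≤ 1) : ∃ n, t ≤ D.cut n y := by
  obtain ⟨n, hn⟩ := D.eventually_cut_eq_one y hy
  exact ⟨n, ht.trans_eq hn.self_of_nhds.symm⟩

theorem cut_mem_Icc (n : ℕ) (y : Y) : D.cut n y ∈ Icc (0 : ℝ) 1 :=
  ⟨(D.cut_zero y).symm.trans_le (D.cut_mono y (Nat.zero_le n)), D.cut_le_one n y⟩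

theorem sel_of_mem {y : Y} (hy : y ∈ X) (t : ℝ) : D.sel y t = ⟨y, hy⟩ := by
  simp [sel, val, hy]

theorem sel_of_mem_Ioc {y : Y} (hy : y ∉ X) {t : ℝ} {n : ℕ}
    (ht : t ∈ Ioc (D.cut n y) (D.cut (n + 1) y)) : D.sel y t = D.pt n y := by
  simp [sel, val, hy, idx_eq ht]

theorem mem_supp_self {y : Y} (hy : y ∈ X) : (⟨y, hy⟩ : X) ∈ D.supp y := Or.inl rfl

theorem supp_of_mem {y : Y} (hy : y ∈ X) : D.supp y = {⟨y, hy⟩} := by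
  ext p
  simp [supp, hy, Subtype.ext_iff]

theorem mem_tsupport_of_lt {y : Y} {n : ℕ} (h : D.cut n y < D.cut (n + 1) y) :
    y ∈ tsupport (D.cut (n + 1) - D.cut n) := by
  refine subset_tsupport _ ?_
  simpa [sub_eq_zero] using h.ne'

theorem sel_mem_supp (y : Y) {t : ℝ} (ht : t ∈ Ioc (0 : ℝ) 1) : D.sel y t ∈ D.supp y := by
  by_cases hy : y ∈ X
  · rw [sel_of_mem hy]
    exact mem_supp_self hy
  · have h := mem_Ioc_of_idx ht.1 (D.exists_le_cut hy ht.2)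
    rw [sel_of_mem_Ioc hy h]
    exact Or.inr ⟨hy, _, mem_tsupport_of_lt (h.1.trans_le h.2), rfl⟩

theorem notMem_tsupport {y : Y} {m n : ℕ} (hm : ∀ᶠ z in 𝓝 y, D.cut m z = 1) (hmn : m ≤ n) :
    y ∉ tsupport (D.cut (n + 1) - D.cut n) := by
  rw [notMem_tsupport_iff_eventuallyEq]
  filter_upwards [hm] with z hz
  have h1 : ∀ k, m ≤ k → D.cut k z = 1 := fun k hk =>
    le_antisymm (D.cut_le_one k z) (hz.symm.trans_le (D.cut_mono z hk))
  simp [h1 n hmn, h1 (n + 1) (by omega)]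

theorem finite_supp (y : Y) : (D.supp y).Finite := by
  by_cases hy : y ∈ X
  · rw [supp_of_mem hy]
    exact finite_singleton _
  · obtain ⟨m, hm⟩ := D.eventually_cut_eq_one y hy
    refine ((finite_Iio m).image fun n => D.pt n y).subset ?_
    rintro p (h | ⟨-, n, hn, rfl⟩)
    · exact (hy (h ▸ p.2)).elim
    · refine mem_image_of_mem _ ?_
      by_contra hmn
      exact notMem_tsupport hm (not_lt.1 hmn) hn

/-- Off `X`, the values of the scheme are locally constant. -/
theorem eventually_tsupport_imp {y : Y} (hy : y ∉ X) :
    ∃ m, ∀ᶠ z in 𝓝 y, D.cut m z = 1 ∧ ∀ n, z ∈ tsupport (D.cut (n + 1) - D.cut n) →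
      y ∈ tsupport (D.cut (n + 1) - D.cut n) ∧ D.pt n z = D.pt n y := by
  obtain ⟨m, hm⟩ := D.eventually_cut_eq_one y hy
  have hfin : ∀ᶠ z in 𝓝 y, ∀ n ∈ Iio m, z ∈ tsupport (D.cut (n + 1) - D.cut n) →
      y ∈ tsupport (D.cut (n + 1) - D.cut n) ∧ D.pt n z = D.pt n y := by
    rw [eventually_all_finite (finite_Iio m)]
    intro n _
    by_cases hn : y ∈ tsupport (D.cut (n + 1) - D.cut n)
    · filter_upwards [D.eventually_pt_eq y hy n hn] with z hz _ using ⟨hn, hz⟩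
    · filter_upwards [(isClosed_tsupport _).isOpen_compl.mem_nhds hn] with z hz hz'
        using (hz hz').elim
  refine ⟨m, ?_⟩
  filter_upwards [hm, hm.eventually_nhds, hfin] with z h1 h2 h3
  refine ⟨h1, fun n hn => h3 n ?_ hn⟩
  by_contra hmn
  exact notMem_tsupport h2 (not_lt.1 hmn) hn

/-- The supports form an upper semicontinuous family. -/
theorem eventually_supp_subset (hX : IsClosed X) (y : Y) {U : Set X} (hU : IsOpen U)
    (h : D.supp y ⊆ U) : ∀ᶠ z in 𝓝 y, D.supp z ⊆ U := by
  by_cases hy : y ∈ X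
  · obtain ⟨V, hV, rfl⟩ := isOpen_induced_iff.1 hU
    have hyV : V ∈ 𝓝 y := hV.mem_nhds (h (mem_supp_self hy))
    filter_upwards [hyV, D.eventually_pt_mem y hy V hyV] with z hz hz'
    rintro p (rfl | ⟨-, n, hn, rfl⟩)
    · exact hz
    · exact hz' n hn
  · obtain ⟨m, hm⟩ := D.eventually_tsupport_imp hy
    filter_upwards [hm, hX.isOpen_compl.mem_nhds hy] with z hz hzX
    rintro p (rfl | ⟨-, n, hn, rfl⟩)
    · exact (hzX p.2).elim
    · obtain ⟨h1, h2⟩ := hz.2 n hn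
      rw [h2]
      exact h (Or.inr ⟨hy, n, h1, rfl⟩)

/-- The points relevant to a compact set form a compact set. -/
theorem isCompact_biUnion_supp (hX : IsClosed X) {K : Set Y} (hK : IsCompact K) :
    IsCompact (⋃ y ∈ K, D.supp y) := by
  rw [isCompact_iff_finite_subcover]
  intro ι U hU hKU
  have hloc : ∃ t : Finset ι, ⋃ y ∈ K, D.supp y ⊆ ⋃ i ∈ t, U i := by
    simp only [iUnion_subset_iff]
    -- Being covered by a finite subfamily is a local property of `y`, by upper semicontinuity of
    -- the supports.
    refine hK.induction_on (p := fun s => ∃ t : Finset ι, ∀ y ∈ s, D.supp y ⊆ ⋃ i ∈ t, U i)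
      ⟨∅, by simp⟩ ?_ ?_ ?_
    · rintro s s' hss ⟨t, ht⟩
      exact ⟨t, fun y hy => ht y (hss hy)⟩
    · classical
      rintro s s' ⟨t, ht⟩ ⟨t', ht'⟩
      refine ⟨t ∪ t', ?_⟩
      rintro y (hy | hy)
      · exact (ht y hy).trans (biUnion_subset_biUnion_left fun i hi => Finset.mem_union_left _ hi)
      · exact (ht' y hy).trans
          (biUnion_subset_biUnion_left fun i hi => Finset.mem_union_right _ hi)
    · intro y hy
      obtain ⟨t, ht⟩ := (finite_supp y).isCompact.elim_finite_subcover U hU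
        ((subset_biUnion_of_mem (u := fun y => D.supp y) hy).trans hKU)
      exact ⟨_, mem_nhdsWithin_of_mem_nhds (eventually_supp_subset hX y
        (isOpen_biUnion fun i _ => hU i) ht), t, fun z hz => hz⟩
  exact hloc

/-! ### The mean value and its continuity -/

/-- The fibre over `0` also contains every `t` above all cuts, since `sInf ∅ = 0`; it is therefore
treated as the complement of the others. -/
theorem measurable_idx (y : Y) : Measurable (D.idx y) := by
  have hs : ∀ n, D.idx y ⁻¹' {n + 1} = Ioc (D.cut (n + 1) y) (D.cut (n + 1 + 1) y) := by
    intro n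
    ext t
    refine ⟨fun h => ?_, fun h => idx_eq h⟩
    have h' : D.idx y t = n + 1 := h
    have hmem : n + 1 ∈ {n | t ≤ D.cut (n + 1) y} := by
      rw [← h']
      exact Nat.sInf_mem (Nat.nonempty_of_sInf_eq_succ h')
    refine ⟨?_, hmem⟩
    by_contra! hle
    have : D.idx y t ≤ n := Nat.sInf_le hle
    omega
  refine measurable_to_countable' fun n => ?_
  rcases n with _ | n
  · have : D.idx y ⁻¹' {0} = (⋃ n, D.idx y ⁻¹' {n + 1})ᶜ := by
      ext t
      simp only [mem_preimage, mem_singleton_iff, mem_compl_iff, mem_iUnion, not_exists]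
      refine ⟨fun h n => by omega, fun h => ?_⟩
      rcases hk : D.idx y t with _ | k
      · rfl
      · exact (h k hk).elim
    rw [this]
    exact (MeasurableSet.iUnion fun n => by rw [hs]; exact measurableSet_Ioc).compl
  · rw [hs]
    exact measurableSet_Ioc

/-- No regularity of `F` is needed: the integrand factors through a pair of measurable indices and
takes finitely many values on `(0, 1]`. -/
theorem intervalIntegrable_sel (F : X → X → ℝ) (y y' : Y) {a b : ℝ} (ha : a ∈ Icc (0 : ℝ) 1)
    (hb : b ∈ Icc (0 : ℝ) 1) :
    IntervalIntegrable (fun t => F (D.sel y t) (D.sel y' t)) volume a b := by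
  have hmeas : Measurable fun t => F (D.sel y t) (D.sel y' t) :=
    Measurable.comp (g := fun p : ℕ × ℕ => F (D.val y p.1) (D.val y' p.2)) (.of_discrete)
      ((measurable_idx y).prodMk (measurable_idx y'))
  obtain ⟨M, hM⟩ := (((finite_supp (D := D) y).prod (finite_supp (D := D) y')).image
    fun p => ‖F p.1 p.2‖).bddAbove
  have hint : IntegrableOn (fun t => F (D.sel y t) (D.sel y' t)) (Ioc (0 : ℝ) 1) := by
    refine Measure.integrableOn_of_bounded (M := M) measure_Ioc_lt_top.ne
      hmeas.aestronglyMeasurable ?_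
    refine (ae_restrict_iff' measurableSet_Ioc).2 (ae_of_all _ fun t ht => ?_)
    exact hM ⟨(D.sel y t, D.sel y' t), ⟨sel_mem_supp y ht, sel_mem_supp y' ht⟩, rfl⟩
  rw [intervalIntegrable_iff]
  exact hint.mono_set (Ioc_subset_Ioc (le_inf ha.1 hb.1) (sup_le ha.2 hb.2))

variable (D)

/-- The mean value of `f` over the random pairs attached to `y` and `y'`. -/
noncomputable def mean (f : X × X → ℝ) (y y' : Y) : ℝ :=
  ∫ t in (0 : ℝ)..1, f (D.sel y t, D.sel y' t)

variable {D}

theorem intervalIntegrable_mean (f : X × X → ℝ) (y y' : Y) :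
    IntervalIntegrable (fun t => f (D.sel y t, D.sel y' t)) volume 0 1 :=
  intervalIntegrable_sel (fun p q => f (p, q)) y y' (by simp) (by simp)

theorem mean_add (f f' : X × X → ℝ) (y y' : Y) :
    D.mean (f + f') y y' = D.mean f y y' + D.mean f' y y' :=
  intervalIntegral.integral_add (intervalIntegrable_mean f y y') (intervalIntegrable_mean f' y y')

theorem mean_smul (c : ℝ) (f : X × X → ℝ) (y y' : Y) : D.mean (c • f) y y' = c * D.mean f y y' :=
  intervalIntegral.integral_const_mul _ _

theorem mean_of_mem (f : X × X → ℝ) {x x' : Y} (hx : x ∈ X) (hx' : x' ∈ X) :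
    D.mean f x x' = f (⟨x, hx⟩, ⟨x', hx'⟩) := by
  simp [mean, sel_of_mem hx, sel_of_mem hx']

theorem mean_one (y y' : Y) : D.mean (fun _ => 1) y y' = 1 := by
  simp [mean]

theorem abs_mean_le {f : X × X → ℝ} {y y' : Y} {M : ℝ}
    (h : ∀ p ∈ D.supp y, ∀ q ∈ D.supp y', |f (p, q)| ≤ M) : |D.mean f y y'| ≤ M := by
  have := intervalIntegral.norm_integral_le_of_norm_le_const (a := 0) (b := 1) (C := M)
    (f := fun t => f (D.sel y t, D.sel y' t)) fun t ht => by
      rw [uIoc_of_le zero_le_one] at ht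
      exact h _ (sel_mem_supp y ht) _ (sel_mem_supp y' ht)
  simpa [mean] using this

theorem mean_triangle {f : X × X → ℝ} (h : ∀ p q r, f (p, r) ≤ f (p, q) + f (q, r)) (x y z : Y) :
    D.mean f x z ≤ D.mean f x y + D.mean f y z := by
  unfold mean
  rw [← intervalIntegral.integral_add (intervalIntegrable_mean f x y)
    (intervalIntegrable_mean f y z)]
  exact intervalIntegral.integral_mono_on_of_le_Ioo zero_le_one (intervalIntegrable_mean f x z)
    ((intervalIntegrable_mean f x y).add (intervalIntegrable_mean f y z)) fun t ht => h _ _ _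

/-- The mean value as a sum over the intervals attached to the second variable. -/
theorem mean_eq_sum (f : X × X → ℝ) (y : Y) {y' : Y} (hy' : y' ∉ X) {m : ℕ}
    (hm : D.cut m y' = 1) :
    D.mean f y y' = ∑ n ∈ Finset.range m,
      ∫ t in (D.cut n y')..(D.cut (n + 1) y'), f (D.sel y t, D.pt n y') := by
  have h := intervalIntegral.sum_integral_adjacent_intervals (μ := volume)
    (f := fun t => f (D.sel y t, D.sel y' t)) (a := fun n => D.cut n y') (n := m) fun n _ =>
      intervalIntegrable_sel (fun p q => f (p, q)) y y' (cut_mem_Icc n y') (cut_mem_Icc _ y')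
  simp only [D.cut_zero, hm] at h
  rw [mean, ← h]
  refine Finset.sum_congr rfl fun n _ => ?_
  refine intervalIntegral.integral_congr_uIoo fun t ht => ?_
  rw [uIoo_of_le (D.cut_mono y' n.le_succ)] at ht
  simp only [sel_of_mem_Ioc hy' ⟨ht.1, ht.2.le⟩]

/-- The estimate is uniform in the first variable near `y₀`. If `y₀' ∈ X`, its support is a single
point and the tube lemma applies. Otherwise the attached points are locally constant, and only the
interval endpoints move, against locally bounded integrands. -/
theorem eventually_abs_mean_sub_le (hX : IsClosed X) (f : C(X × X, ℝ)) (y₀ y₀' : Y) {ε : ℝ}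
    (hε : 0 < ε) :
    ∀ᶠ p in 𝓝 y₀ ×ˢ 𝓝 y₀', |D.mean f p.1 p.2 - D.mean f p.1 y₀'| ≤ ε := by
  by_cases hy : y₀' ∈ X
  · have hO : IsOpen {p : X × X | |f p - f (p.1, ⟨y₀', hy⟩)| < ε} :=
      isOpen_lt (by fun_prop) continuous_const
    obtain ⟨u, v, hu, hv, hsu, htv, huv⟩ := generalized_tube_lemma
      (finite_supp (D := D) y₀).isCompact (isCompact_singleton (x := (⟨y₀', hy⟩ : X))) hO (by
        rintro ⟨p, q⟩ ⟨-, rfl⟩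
        simpa using hε)
    filter_upwards [(eventually_supp_subset hX y₀ hu hsu).prod_mk (eventually_supp_subset hX y₀' hv
      ((supp_of_mem hy).trans_subset htv))]
    rintro ⟨y, y'⟩ ⟨hyu, hyv⟩
    rw [mean, mean, ← intervalIntegral.integral_sub (intervalIntegrable_mean f y y')
      (intervalIntegrable_mean f y y₀')]
    have := intervalIntegral.norm_integral_le_of_norm_le_const (a := 0) (b := 1) (C := ε)
      (f := fun t => f (D.sel y t, D.sel y' t) - f (D.sel y t, D.sel y₀' t)) fun t ht => by
        rw [uIoc_of_le zero_le_one] at ht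
        rw [sel_of_mem hy]
        exact (huv (mk_mem_prod (hyu (sel_mem_supp y ht)) (hyv (sel_mem_supp y' ht)))).le
    simpa using this
  · obtain ⟨m, hm⟩ := D.eventually_tsupport_imp hy
    have hbd : ∀ n, ∃ M, ∀ᶠ y in 𝓝 y₀, ∀ p ∈ D.supp y, |f (p, D.pt n y₀')| ≤ M := by
      intro n
      obtain ⟨M, hM⟩ := ((finite_supp (D := D) y₀).image fun p => |f (p, D.pt n y₀')|).bddAbove
      have hO : IsOpen {p : X | |f (p, D.pt n y₀')| < M + 1} :=
        isOpen_lt (by fun_prop) continuous_const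
      refine ⟨M + 1, ?_⟩
      filter_upwards [eventually_supp_subset hX y₀ hO fun p hp =>
        (hM (mem_image_of_mem _ hp)).trans_lt (lt_add_one M)] with y hy p hp
      exact (hy hp).le
    choose M hM using hbd
    have hMev : ∀ᶠ y in 𝓝 y₀, ∀ n ∈ Iio m, ∀ p ∈ D.supp y, |f (p, D.pt n y₀')| ≤ M n :=
      (eventually_all_finite (finite_Iio m)).2 fun n _ => hM n
    have hcont : Continuous fun y' => ∑ n ∈ Finset.range m,
        (M n * |D.cut n y₀' - D.cut n y'| + M n * |D.cut (n + 1) y₀' - D.cut (n + 1) y'|) := by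
      fun_prop
    have hsmall : ∀ᶠ y' in 𝓝 y₀', ∑ n ∈ Finset.range m,
        (M n * |D.cut n y₀' - D.cut n y'| + M n * |D.cut (n + 1) y₀' - D.cut (n + 1) y'|) < ε :=
      hcont.continuousAt.eventually_lt continuousAt_const (by simpa using hε)
    filter_upwards [hMev.prod_mk ((hm.and hsmall).and (hX.isOpen_compl.mem_nhds hy))]
    rintro ⟨y, y'⟩ ⟨h1, ⟨⟨h2, h3⟩, h4⟩, h5⟩
    have hm0 : D.cut m y₀' = 1 := hm.self_of_nhds.1
    simp only at h1 h2 h3 h4 h5 ⊢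
    rw [mean_eq_sum f y h5 h2, mean_eq_sum f y hy hm0, ← Finset.sum_sub_distrib]
    refine (Finset.abs_sum_le_sum_abs _ _).trans ((Finset.sum_le_sum fun n hn => ?_).trans h4.le)
    have hint : ∀ a ∈ Icc (0 : ℝ) 1, ∀ b ∈ Icc (0 : ℝ) 1,
        IntervalIntegrable (fun t => f (D.sel y t, D.pt n y₀')) volume a b := fun a ha b hb =>
      intervalIntegrable_sel (fun p _ => f (p, D.pt n y₀')) y y ha hb
    have hest : ∀ a ∈ Icc (0 : ℝ) 1, ∀ b ∈ Icc (0 : ℝ) 1,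
        |∫ t in a..b, f (D.sel y t, D.pt n y₀')| ≤ M n * |b - a| := by
      intro a ha b hb
      refine intervalIntegral.norm_integral_le_of_norm_le_const
        (f := fun t => f (D.sel y t, D.pt n y₀')) fun t ht => ?_
      exact h1 n (Finset.mem_range.1 hn) _ (sel_mem_supp y
        (Ioc_subset_Ioc (le_inf ha.1 hb.1) (sup_le ha.2 hb.2) ht))
    have heq : ∫ t in (D.cut n y')..(D.cut (n + 1) y'), f (D.sel y t, D.pt n y') =
        ∫ t in (D.cut n y')..(D.cut (n + 1) y'), f (D.sel y t, D.pt n y₀') := by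
      -- The attached points are known to agree only when the interval is nondegenerate; a
      -- degenerate one contributes zero.
      rcases (D.cut_mono y' n.le_succ).eq_or_lt with h | h
      · simp only [Nat.succ_eq_add_one] at h
        rw [← h, intervalIntegral.integral_same, intervalIntegral.integral_same]
      · rw [(h3 n (mem_tsupport_of_lt h)).2]
    have i1 := cut_mem_Icc (D := D) n y'
    have i2 := cut_mem_Icc (D := D) (n + 1) y'
    have i3 := cut_mem_Icc (D := D) n y₀'
    have i4 := cut_mem_Icc (D := D) (n + 1) y₀'
    -- The difference over two intervals becomes one integral between left endpoints minus one
    -- between right endpoints.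
    rw [heq, intervalIntegral.integral_interval_sub_interval_comm (hint _ i1 _ i2)
      (hint _ i3 _ i4) (hint _ i1 _ i3)]
    exact (abs_sub _ _).trans (add_le_add (hest _ i1 _ i3) (hest _ i2 _ i4))

theorem continuous_mean (hX : IsClosed X) (f : C(X × X, ℝ)) :
    Continuous fun p : Y × Y => D.mean f p.1 p.2 := by
  rw [continuous_iff_continuousAt]
  rintro ⟨y₀, y₀'⟩
  rw [ContinuousAt, nhds_prod_eq, Metric.tendsto_nhds]
  intro ε hε
  -- Swapping the factors gives control of the first variable, with the second frozen at `y₀'`.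
  have hs := (eventually_abs_mean_sub_le (D := D) hX (f.comp ContinuousMap.prodSwap) y₀' y₀
    (half_pos (half_pos hε))).curry.self_of_nhds
  filter_upwards [eventually_abs_mean_sub_le (D := D) hX f y₀ y₀' (half_pos (half_pos hε)),
    hs.prod_inl (𝓝 y₀')]
  rintro ⟨y, y'⟩ h1 h2
  have h2' : |D.mean f y y₀' - D.mean f y₀ y₀'| ≤ ε / 2 / 2 := h2
  rw [Real.dist_eq]
  have := abs_sub_le (D.mean f y y') (D.mean f y y₀') (D.mean f y₀ y₀')
  simp only at h1 ⊢
  linarith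

end CutScheme

/-! ### Averaging over the group -/

theorem ContinuousMap.continuous_integral {K : Type*} [TopologicalSpace K] [CompactSpace K]
    [MeasurableSpace K] [BorelSpace K] (μ : Measure K) [IsProbabilityMeasure μ] :
    Continuous fun h : C(K, ℝ) => ∫ g, h g ∂μ := by
  have hint : ∀ h : C(K, ℝ), Integrable h μ := fun h =>
    h.continuous.integrable_of_hasCompactSupport (HasCompactSupport.of_compactSpace _)
  refine (LipschitzWith.of_dist_le_mul (K := 1) fun h h' => ?_).continuous
  rw [Real.dist_eq, ← integral_sub (hint h) (hint h')]
  have := norm_integral_le_of_norm_le_const (μ := μ) (f := fun g => h g - h' g) (C := dist h h')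
    (ae_of_all _ fun g => by
      rw [← dist_eq_norm]
      exact ContinuousMap.dist_apply_le_dist g)
  simpa using this

section Averaging

variable {G : Type*} [Group G] [TopologicalSpace G] [IsTopologicalGroup G] [CompactSpace G]
  [MeasurableSpace G] [BorelSpace G] {Z : Type*} [TopologicalSpace Z] [MulAction G Z]
  [ContinuousSMul G Z] (μ : Measure G) [IsProbabilityMeasure μ]

/-- The average of a continuous function over the diagonal action of a compact group. -/
noncomputable def diagonalAverage (F : C(Z × Z, ℝ)) : C(Z × Z, ℝ) where
  toFun p := ∫ g, F (g⁻¹ • p.1, g⁻¹ • p.2) ∂μ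
  continuous_toFun := by
    -- Currying gives a continuous map into `C(G, ℝ)`, on which integration is 1-Lipschitz.
    let H : C((Z × Z) × G, ℝ) := ⟨fun q => F (q.2⁻¹ • q.1.1, q.2⁻¹ • q.1.2), by fun_prop⟩
    exact (ContinuousMap.continuous_integral μ).comp H.curry.continuous

theorem integrable_diagonal (F : C(Z × Z, ℝ)) (x y : Z) :
    Integrable (fun g : G => F (g⁻¹ • x, g⁻¹ • y)) μ :=
  Continuous.integrable_of_hasCompactSupport (by fun_prop) (HasCompactSupport.of_compactSpace _)

/-- Since the average uses `g⁻¹`, the substitution `g ↦ h⁻¹ * g` absorbs `h`, so left invariance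
suffices. -/
theorem diagonalAverage_smul [μ.IsMulLeftInvariant] (F : C(Z × Z, ℝ)) (h : G) (x y : Z) :
    diagonalAverage μ F (h • x, h • y) = diagonalAverage μ F (x, y) := by
  have := integral_mul_left_eq_self (μ := μ) (fun g : G => F (g⁻¹ • x, g⁻¹ • y)) h⁻¹
  simp only [mul_inv_rev, inv_inv, mul_smul] at this
  exact this

end Averaging

/-! ### The extension operator and its properties -/

section Extension

variable {G : Type*} [Group G] {Y : Type*} [TopologicalSpace Y] [MulAction G Y]
  {X : SubMulAction G Y}

/-- The mean value extension, as a continuous function. -/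
noncomputable def CutScheme.meanMap (D : CutScheme (X : Set Y)) (hX : IsClosed (X : Set Y))
    (f : C(X × X, ℝ)) : C(Y × Y, ℝ) :=
  ⟨fun p => D.mean f p.1 p.2, CutScheme.continuous_mean hX f⟩

variable [TopologicalSpace G] [IsTopologicalGroup G] [CompactSpace G]
  [MeasurableSpace G] [BorelSpace G] [ContinuousSMul G Y] (μ : Measure G) [IsProbabilityMeasure μ]

theorem CutScheme.integrable_mean {D : CutScheme (X : Set Y)} (hX : IsClosed (X : Set Y))
    (f : C(X × X, ℝ)) (y y' : Y) :
    Integrable (fun g : G => D.mean f (g⁻¹ • y) (g⁻¹ • y')) μ :=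
  integrable_diagonal μ (D.meanMap hX f) y y'

variable [μ.IsMulLeftInvariant]

/-- The extension operator: the mean value extension, averaged over the group. -/
noncomputable def CutScheme.extension (D : CutScheme (X : Set Y)) (hX : IsClosed (X : Set Y)) :
    CInv G X →ₗ[ℝ] CInv G Y where
  toFun f := ⟨diagonalAverage μ (D.meanMap hX f.1), diagonalAverage_smul μ _⟩
  map_add' f f' := by
    ext p
    have : ∀ y y', D.meanMap hX (f.1 + f'.1) (y, y') =
        D.meanMap hX f.1 (y, y') + D.meanMap hX f'.1 (y, y') := fun y y' =>
      CutScheme.mean_add (D := D) (f.1 : X × X → ℝ) (f'.1 : X × X → ℝ) y y'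
    change ∫ g, D.meanMap hX (f.1 + f'.1) (g⁻¹ • p.1, g⁻¹ • p.2) ∂μ =
      ∫ g, D.meanMap hX f.1 (g⁻¹ • p.1, g⁻¹ • p.2) ∂μ +
        ∫ g, D.meanMap hX f'.1 (g⁻¹ • p.1, g⁻¹ • p.2) ∂μ
    simp only [this]
    exact integral_add (integrable_diagonal μ _ _ _) (integrable_diagonal μ _ _ _)
  map_smul' c f := by
    ext p
    have : ∀ y y', D.meanMap hX (c • f.1) (y, y') = c * D.meanMap hX f.1 (y, y') := fun y y' =>
      CutScheme.mean_smul (D := D) c (f.1 : X × X → ℝ) y y'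
    change ∫ g, D.meanMap hX (c • f.1) (g⁻¹ • p.1, g⁻¹ • p.2) ∂μ =
      c * ∫ g, D.meanMap hX f.1 (g⁻¹ • p.1, g⁻¹ • p.2) ∂μ
    simp only [this]
    exact integral_const_mul _ _

namespace CutScheme

variable {μ} {D : CutScheme (X : Set Y)} {hX : IsClosed (X : Set Y)}

theorem extension_apply (f : CInv G X) (y y' : Y) :
    (D.extension μ hX f).1 (y, y') = ∫ g : G, D.mean f.1 (g⁻¹ • y) (g⁻¹ • y') ∂μ := rfl

theorem isRegularOperator_extension : IsRegularOperator (D.extension μ hX) := by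
  refine ⟨fun f hf w => ?_, ?_⟩
  · rw [← Prod.mk.eta (p := w), extension_apply]
    exact integral_nonneg fun g => intervalIntegral.integral_nonneg zero_le_one fun t _ => hf _
  · ext w
    rw [← Prod.mk.eta (p := w), extension_apply]
    have : ∀ y y', D.mean (CInv.unit G X).1 y y' = 1 := fun y y' => mean_one y y'
    simp only [this]
    simp [CInv.unit]

/-- Translates of points of `X` stay in `X`, where the mean is `f` itself; invariance of `f` makes
the averaged function constant. -/
theorem isExtensionOperator_extension : IsExtensionOperator (D.extension μ hX) := by
  intro f x y
  rw [extension_apply]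
  have : ∀ g : G, D.mean f.1 (g⁻¹ • (x : Y)) (g⁻¹ • (y : Y)) = f.1 (x, y) := by
    intro g
    rw [mean_of_mem _ (X.smul_mem g⁻¹ x.2) (X.smul_mem g⁻¹ y.2)]
    exact f.2 g⁻¹ x y
  simp [this]

theorem isPseudometric_extension {p : CInv G X} (hp : CInv.IsPseudometric p) :
    CInv.IsPseudometric (D.extension μ hX p) := by
  obtain ⟨d, hd⟩ := hp
  refine ⟨⟨fun x y => (D.extension μ hX p).1 (x, y), fun x => ?_, fun x y => ?_,
    fun x y z => ?_⟩, fun x y => rfl⟩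
  · have : ∀ y, D.mean p.1 y y = 0 := by
      intro y
      have h0 : ∀ q : X, p.1 (q, q) = 0 := fun q => (hd q q).trans (d.refl' q)
      simp [mean, h0]
    simp [extension_apply, this]
  · have : ∀ y y', D.mean p.1 y y' = D.mean p.1 y' y := by
      intro y y'
      have hs : ∀ q r : X, p.1 (q, r) = p.1 (r, q) := fun q r => by
        rw [hd, hd]; exact d.symm' q r
      simp only [mean, hs (D.sel y _)]
    simp only [extension_apply, this (_ • x)]
  · simp only [extension_apply]
    rw [← integral_add (integrable_mean μ hX p.1 x y) (integrable_mean μ hX p.1 y z)]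
    refine integral_mono (integrable_mean μ hX p.1 x z)
      ((integrable_mean μ hX p.1 x y).add (integrable_mean μ hX p.1 y z)) fun g => ?_
    refine mean_triangle (fun q r s => ?_) _ _ _
    change p.1 (q, s) ≤ p.1 (q, r) + p.1 (r, s)
    rw [hd, hd, hd]
    exact d.triangle' q r s

theorem abs_extension_sub_le {f f' : CInv G X} {y y' : Y} {ε : ℝ}
    (h : ∀ g : G, ∀ p ∈ D.supp (g⁻¹ • y), ∀ q ∈ D.supp (g⁻¹ • y'), |f.1 (p, q) - f'.1 (p, q)| ≤ ε) :
    |(D.extension μ hX f).1 (y, y') - (D.extension μ hX f').1 (y, y')| ≤ ε := by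
  have hsub : (D.extension μ hX f).1 (y, y') - (D.extension μ hX f').1 (y, y') =
      (D.extension μ hX (f - f')).1 (y, y') := by
    rw [map_sub]; rfl
  rw [hsub, extension_apply]
  have := norm_integral_le_of_norm_le_const (μ := μ) (C := ε)
    (f := fun g : G => D.mean (f - f').1 (g⁻¹ • y) (g⁻¹ • y'))
    (ae_of_all _ fun g => abs_mean_le fun p hp q hq => h g p hp q hq)
  simpa using this

theorem continuous_extension : Continuous (D.extension μ hX) := by
  rw [continuous_induced_rng, continuous_iff_continuousAt]
  intro f
  rw [ContinuousAt, ContinuousMap.tendsto_iff_forall_isCompact_tendstoUniformlyOn]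
  intro K hK
  rw [Metric.tendstoUniformlyOn_iff]
  intro ε hε
  -- The `G`-saturation of both projections of `K`, compact because `G` is; values on `K` involve
  -- `f` only on the square of its total support.
  let K₁ : Set Y := (fun q : G × Y => q.1⁻¹ • q.2) '' (univ ×ˢ (Prod.fst '' K ∪ Prod.snd '' K))
  have hK₁ : IsCompact K₁ := (isCompact_univ.prod
    ((hK.image continuous_fst).union (hK.image continuous_snd))).image (by fun_prop)
  have hL := isCompact_biUnion_supp (D := D) hX hK₁
  have hf : Tendsto (fun f' : CInv G X => f'.1) (𝓝 f) (𝓝 f.1) :=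
    continuous_subtype_val.continuousAt
  have hu := (ContinuousMap.tendsto_iff_forall_isCompact_tendstoUniformlyOn.1 hf) _ (hL.prod hL)
  rw [Metric.tendstoUniformlyOn_iff] at hu
  filter_upwards [hu (ε / 2) (half_pos hε)] with f' hf'
  rintro ⟨y, y'⟩ hy
  refine lt_of_le_of_lt ?_ (half_lt_self hε)
  refine abs_extension_sub_le fun g p hp q hq => ?_
  refine (hf' (p, q) (mk_mem_prod (mem_biUnion ?_ hp) (mem_biUnion ?_ hq))).le
  · exact ⟨(g, y), ⟨mem_univ _, Or.inl ⟨_, hy, rfl⟩⟩, rfl⟩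
  · exact ⟨(g, y'), ⟨mem_univ _, Or.inr ⟨_, hy, rfl⟩⟩, rfl⟩

/-- For finite `G`, each value of the extension depends on finitely many values of `f`. -/
theorem continuous_extension_pointwise [Finite G] :
    Continuous[CInv.pointwiseTopology G X, CInv.pointwiseTopology G Y] (D.extension μ hX) := by
  let := CInv.pointwiseTopology G X
  rw [continuous_induced_rng, continuous_pi_iff]
  rintro ⟨y, y'⟩
  rw [continuous_iff_continuousAt]
  intro f
  rw [ContinuousAt, Metric.tendsto_nhds]
  intro ε hε
  have hfin : ∀ z : Y, (⋃ g : G, D.supp (g⁻¹ • z)).Finite := fun z =>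
    finite_iUnion fun g => finite_supp _
  have hev : ∀ z : X × X, Continuous fun f' : CInv G X => f'.1 z := fun z =>
    (continuous_apply z).comp continuous_induced_dom
  have hall : ∀ᶠ f' in 𝓝 f, ∀ z ∈ (⋃ g : G, D.supp (g⁻¹ • y)) ×ˢ (⋃ g : G, D.supp (g⁻¹ • y')),
      dist (f'.1 z) (f.1 z) < ε / 2 :=
    (eventually_all_finite ((hfin y).prod (hfin y'))).2 fun z _ =>
      Metric.tendsto_nhds.1 (hev z).continuousAt _ (half_pos hε)
  filter_upwards [hall] with f' hf'
  refine lt_of_le_of_lt ?_ (half_lt_self hε)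
  refine abs_extension_sub_le fun g p hp q hq => ?_
  exact (hf' (p, q) (mk_mem_prod (mem_iUnion.2 ⟨g, hp⟩) (mem_iUnion.2 ⟨g, hq⟩))).le

end CutScheme

end Extension

theorem theorem4p1 {G : Type*} [Group G] [TopologicalSpace G] [IsTopologicalGroup G]
    [CompactSpace G] {Y : Type*} [TopologicalSpace Y] [StratifiableSpace Y] [MulAction G Y]
    [ContinuousSMul G Y] (X : SubMulAction G Y) (hX : IsClosed (X : Set Y))
    (hne : (X : Set Y).Nonempty) :
    ∃ T : CInv G X →ₗ[ℝ] CInv G Y,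
      IsRegularOperator T ∧
      IsExtensionOperator T ∧
      Continuous T ∧
      (∀ p : CInv G X, CInv.IsPseudometric p → CInv.IsPseudometric (T p)) ∧
      (Finite G →
        Continuous[CInv.pointwiseTopology G X, CInv.pointwiseTopology G Y] T) := by
  obtain ⟨D⟩ := exists_cutScheme hX hne
  borelize G
  -- Normalising on the whole compact group makes Haar measure a probability measure.
  let μ : Measure G := Measure.haarMeasure ⊤
  have : IsProbabilityMeasure μ := ⟨Measure.haarMeasure_self (K₀ := (⊤ : PositiveCompacts G))⟩
  exact ⟨CutScheme.extension μ D hX, CutScheme.isRegularOperator_extension,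
    CutScheme.isExtensionOperator_extension, CutScheme.continuous_extension,
    fun _ => CutScheme.isPseudometric_extension,
    fun _ => CutScheme.continuous_extension_pointwise⟩
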